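/- Let $n\ge 1$ and let $S_n$ be the set of permutations $\sigma=\sigma_1\cdots\sigma_n$ of $[n]=\{1,\dots,n\}$, with the convention $\sigma_0=0$. For $\sigma\in S_n$ put $$\overline{L}(\sigma)=\{\sigma_i : 1\le i\le n,\ \sigma_{i-1}+1=\sigma_i\},\qquad F(\sigma)=\{i : 1\le i\le n,\ \sigma_i=i\},$$ $$\overline{\mathrm{Jump}}(\sigma)=\{\sigma_i : 1\le i\le n,\ \sigma_{i-1}+2\le\sigma_i\},\qquad \overline{\mathrm{Exc}}(\sigma)=\{\sigma_i : 1\le i\le n,\ \sigma_i>i\}.$$ Let $\mathrm{jump}(\sigma)$ be the number of $i\in[n]$ with $\sigma_{i-1}+2\le\sigma_i$, let $\mathrm{des}(\sigma)$ be the number of $i\in[n-1]$ with $\sigma_i>\sigma_{i+1}$, and let $\mathrm{exc}(\sigma)$ and $\mathrm{drop}(\sigma)$ be the numbers of $i\in[n]$ with $\sigma_i>i$ and with $\sigma_i<i$, respectively. For $I\subseteq[n]$ let $\overline{L}_n(I)=\{\sigma\in S_n:\overline{L}(\sigma)=I\}$ and $F_n(I)=\{\sigma\in S_n: F(\sigma)=I\}$.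 Then for every $I\subseteq[n]$ there is a bijection $\Phi:\overline{L}_n(I)\to F_n(I)$ such that for every $\sigma\in\overline{L}_n(I)$, $$\mathrm{jump}(\sigma)=\mathrm{exc}(\Phi(\sigma)),\qquad \mathrm{des}(\sigma)=\mathrm{drop}(\Phi(\sigma)),\qquad \overline{\mathrm{Jump}}(\sigma)=\overline{\mathrm{Exc}}(\Phi(\sigma)).$$ -/

import Mathlib

namespace LeftSuccession

/-- A permutation `σ` of `[n] = {1, …, n}` is an element of `Equiv.Perm (Fin n)`, where the
element `k` of `[n]` is represented by `k - 1 : Fin n`. In these terms `entry σ i` is the entry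
`σ_i` of the word `σ_1 ⋯ σ_n` for `1 ≤ i ≤ n`, and `σ_0 = 0` by convention
(the value at indices `i > n`, never used below, is also `0`). -/
def entry {n : ℕ} (σ : Equiv.Perm (Fin n)) (i : ℕ) : ℕ :=
  if h : 1 ≤ i ∧ i ≤ n then (σ ⟨i - 1, by omega⟩ : ℕ) + 1 else 0

/-- The set of values `σ_i`, `1 ≤ i ≤ n`, at the left successions: `σ_{i-1} + 1 = σ_i`. -/
def leftSuccValues {n : ℕ} (σ : Equiv.Perm (Fin n)) : Finset ℕ :=
  ((Finset.Icc 1 n).filter (fun i => entry σ (i - 1) + 1 = entry σ i)).image (entry σ)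

/-- The set of jumps: indices `1 ≤ i ≤ n` with `σ_{i-1} + 2 ≤ σ_i`. -/
def jumps {n : ℕ} (σ : Equiv.Perm (Fin n)) : Finset ℕ :=
  (Finset.Icc 1 n).filter (fun i => entry σ (i - 1) + 2 ≤ entry σ i)

/-- The set of descents: indices `1 ≤ i ≤ n - 1` with `σ_i > σ_{i+1}`. -/
def descents {n : ℕ} (σ : Equiv.Perm (Fin n)) : Finset ℕ :=
  (Finset.Icc 1 (n - 1)).filter (fun i => entry σ i > entry σ (i + 1))

/-- The set of excedances: indices `1 ≤ i ≤ n` with `σ_i > i`. -/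
def excedances {n : ℕ} (σ : Equiv.Perm (Fin n)) : Finset ℕ :=
  (Finset.Icc 1 n).filter (fun i => entry σ i > i)

/-- The set of drops: indices `1 ≤ i ≤ n` with `σ_i < i`. -/
def drops {n : ℕ} (σ : Equiv.Perm (Fin n)) : Finset ℕ :=
  (Finset.Icc 1 n).filter (fun i => entry σ i < i)

/-- The set of fixed points: indices `1 ≤ i ≤ n` with `σ_i = i`. -/
def fixedPoints {n : ℕ} (σ : Equiv.Perm (Fin n)) : Finset ℕ :=
  (Finset.Icc 1 n).filter (fun i => entry σ i = i)

/-- The set of jump values `σ_i`, for `i` a jump. -/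
def jumpValues {n : ℕ} (σ : Equiv.Perm (Fin n)) : Finset ℕ := (jumps σ).image (entry σ)

/-- The set of excedance values `σ_i`, for `i` an excedance. -/
def excValues {n : ℕ} (σ : Equiv.Perm (Fin n)) : Finset ℕ := (excedances σ).image (entry σ)

/-- The number of jumps. -/
def jump {n : ℕ} (σ : Equiv.Perm (Fin n)) : ℕ := (jumps σ).card

/-- The number of descents. -/
def des {n : ℕ} (σ : Equiv.Perm (Fin n)) : ℕ := (descents σ).card

/-- The number of excedances. -/
def exc {n : ℕ} (σ : Equiv.Perm (Fin n)) : ℕ := (excedances σ).card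

/-- The number of drops. -/
def drop {n : ℕ} (σ : Equiv.Perm (Fin n)) : ℕ := (drops σ).card

/-- The set of permutations of `[n]` whose set of left-succession values is `I`. -/
def leftSuccPerms (n : ℕ) (I : Finset ℕ) : Set (Equiv.Perm (Fin n)) :=
  {σ | leftSuccValues σ = I}

/-- The set of permutations of `[n]` whose set of fixed points is `I`. -/
def fixPerms (n : ℕ) (I : Finset ℕ) : Set (Equiv.Perm (Fin n)) :=
  {σ | fixedPoints σ = I}

end LeftSuccession

/-!
Every permutation of `[n + 1]` arises exactly once by inserting the letter `n + 1` into the word of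
a permutation `σ` of `[n]` behind some letter `a` of `0 σ_1 ⋯ σ_n`, and exactly once by inserting
`n + 1` into the cycles of a permutation `τ` of `[n]` with a prescribed preimage `a + 1`. Both
insertions change the pairs of ascents `(x, y)` of `0 σ_1 ⋯ σ_n`, and the pairs of weak excedances
`x + 1 ↦ y` of `τ`, in the same way: the pair with `x = a`, if any, is replaced by `(a, n + 1)`.
Using the same `a` at every step thus gives a bijection `σ ↦ τ` taking ascents to weak excedances.
Left successions are the ascents with `y = x + 1`, fixed points are the weak excedances with
`y = x + 1`, and descents and drops are counted by complement.
-/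

namespace LeftSuccession

section InsertPoint

variable {α β γ δ : Type*}

lemma optionCongr_removeNone {e : Option β ≃ Option γ} (he : e none = none) :
    e.removeNone.optionCongr = e := by
  refine Equiv.ext fun x => ?_
  cases x with
  | none => simp [he]
  | some b =>
    have hb : ∃ c, e (some b) = some c :=
      Option.ne_none_iff_exists'.mp fun h => by simpa using e.injective (h.trans he.symm)
    simpa using e.removeNone_some hb

/-- Extension of a bijection `σ : β ≃ γ` by one point `a : α`: the bijection `α ≃ δ` that sends `a`
to `f none` and acts as `σ` on the other points, where `α` without `a` is identified with `β` by
`e a`, and `δ` without `f none` is identified with `γ` by `f`. -/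
def insertPoint (e : α → α ≃ Option β) (he : ∀ a, e a a = none) (f : Option γ ≃ δ) :
    (β ≃ γ) × α ≃ (α ≃ δ) where
  toFun x := (e x.2).trans (x.1.optionCongr.trans f)
  invFun g :=
    ((((e (g.symm (f none))).symm.trans g).trans f.symm).removeNone, g.symm (f none))
  left_inv := by
    rintro ⟨σ, a⟩
    have ha : ((e a).trans (σ.optionCongr.trans f)).symm (f none) = a := by
      simp [Equiv.symm_apply_eq, he]
    have hσ : ((e a).symm.trans ((e a).trans (σ.optionCongr.trans f))).trans f.symm =
        σ.optionCongr := by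
      ext1 x
      simp
    simp only [ha, hσ, Equiv.removeNone_optionCongr]
  right_inv g := by
    have hnone : (e (g.symm (f none))).symm none = g.symm (f none) := by
      rw [Equiv.symm_apply_eq, he]
    ext1 x
    simp [optionCongr_removeNone, hnone]

variable (e : α → α ≃ Option β) (he : ∀ a, e a a = none) (f : Option γ ≃ δ)

lemma insertPoint_self (σ : β ≃ γ) (a : α) : insertPoint e he f (σ, a) a = f none := by
  simp [insertPoint, he]

lemma insertPoint_of_eq_some (σ : β ≃ γ) {a x : α} {b : β} (h : e a x = some b) :
    insertPoint e he f (σ, a) x = f (some (σ b)) := by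
  simp [insertPoint, h]

end InsertPoint

variable {n : ℕ}

section Entries

variable (σ : Equiv.Perm (Fin n))

lemma entry_zero : entry σ 0 = 0 := by simp [entry]

lemma entry_succ (i : Fin n) : entry σ (i + 1) = σ i + 1 := by
  simp [entry]

lemma entry_of_gt {i : ℕ} (hi : n < i) : entry σ i = 0 := by
  simp [entry, hi]

lemma entry_le (i : ℕ) : entry σ i ≤ n := by
  unfold entry
  split_ifs <;> omega

/-- The word `σ_0 σ_1 ⋯ σ_n`, with `σ_0 = 0`, as a permutation of its `n + 1` letters. -/
def word : Equiv.Perm (Fin (n + 1)) := Equiv.Perm.decomposeFin.symm (0, σ)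

lemma coe_word (i : Fin (n + 1)) : (word σ i : ℕ) = entry σ i := by
  cases i using Fin.cases <;> simp [word, entry_zero, entry_succ]

lemma entry_injOn : Set.InjOn (entry σ) (Set.Iic n) := by
  intro i hi j hj hij
  have h : word σ ⟨i, Nat.lt_succ_of_le hi⟩ = word σ ⟨j, Nat.lt_succ_of_le hj⟩ := by
    rwa [Fin.ext_iff, coe_word, coe_word]
  exact Fin.ext_iff.mp ((word σ).injective h)

lemma one_le_entry {i : ℕ} (h1 : 1 ≤ i) (hi : i ≤ n) : 1 ≤ entry σ i := by
  simp [entry, h1, hi]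

end Entries

section InsertWord

/-- Insertion of the letter `n + 1` into the word of a permutation of `[n]`, immediately after the
letter `σ_p` (so at the front if `p = 0`). -/
def insertWord (n : ℕ) : Equiv.Perm (Fin n) × Fin (n + 1) ≃ Equiv.Perm (Fin (n + 1)) :=
  insertPoint finSuccEquiv' finSuccEquiv'_at finSuccEquivLast.symm

variable (σ : Equiv.Perm (Fin n)) (p : Fin (n + 1))

lemma entry_insertWord_self : entry (insertWord n (σ, p)) (p + 1) = n + 1 := by
  rw [entry_succ, insertWord, insertPoint_self, finSuccEquivLast_symm_none, Fin.val_last]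

lemma entry_insertWord_succAbove (i : Fin (n + 1)) :
    entry (insertWord n (σ, p)) (p.succ.succAbove i) = entry σ i := by
  cases i using Fin.cases with
  | zero => simp [entry_zero]
  | succ i =>
    rw [Fin.succ_succAbove_succ, Fin.val_succ, Fin.val_succ, entry_succ, entry_succ, insertWord,
      insertPoint_of_eq_some _ _ _ _ (finSuccEquiv'_succAbove p i), finSuccEquivLast_symm_some,
      Fin.val_castSucc]

lemma entry_insertWord_of_le {i : ℕ} (hi : i ≤ p) :
    entry (insertWord n (σ, p)) i = entry σ i := by
  have h := entry_insertWord_succAbove σ p ⟨i, by omega⟩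
  rwa [Fin.succAbove_of_castSucc_lt _ _ (by simpa [Fin.lt_def, Nat.lt_succ_iff] using hi)] at h

lemma entry_insertWord_of_lt {i : ℕ} (hpi : p < i) (hi : i ≤ n) :
    entry (insertWord n (σ, p)) (i + 1) = entry σ i := by
  have h := entry_insertWord_succAbove σ p ⟨i, by omega⟩
  rwa [Fin.succAbove_of_le_castSucc _ _ (by simpa [Fin.le_def] using hpi)] at h

end InsertWord

section InsertCycle

/-- Insertion of the letter `n + 1` into the cycles of a permutation of `[n]`, with preimage
`a + 1`: it goes between `a + 1` and its image if `a < n`, and is a new fixed point if `a = n`. -/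
def insertCycle (n : ℕ) : Equiv.Perm (Fin n) × Fin (n + 1) ≃ Equiv.Perm (Fin (n + 1)) :=
  insertPoint (fun a => (Equiv.swap a (Fin.last n)).trans finSuccEquivLast)
    (fun a => by simp) finSuccEquivLast.symm

variable (τ : Equiv.Perm (Fin n)) (a : Fin (n + 1))

lemma entry_insertCycle_self : entry (insertCycle n (τ, a)) (a + 1) = n + 1 := by
  rw [entry_succ, insertCycle, insertPoint_self, finSuccEquivLast_symm_none, Fin.val_last]

lemma entry_insertCycle_last (ha : (a : ℕ) < n) :
    entry (insertCycle n (τ, a)) (n + 1) = entry τ (a + 1) := by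
  have hlast : ((Equiv.swap a (Fin.last n)).trans finSuccEquivLast) (Fin.last n) =
      some ⟨a, ha⟩ := by
    rw [Equiv.trans_apply, Equiv.swap_apply_right]
    exact finSuccEquivLast_castSucc ⟨a, ha⟩
  have h := entry_succ (insertCycle n (τ, a)) (Fin.last n)
  rw [insertCycle, insertPoint_of_eq_some _ _ _ _ hlast, finSuccEquivLast_symm_some] at h
  simpa [insertCycle] using h.trans (entry_succ τ ⟨a, ha⟩).symm

lemma entry_insertCycle_of_ne {k : ℕ} (hk : k < n) (hka : k ≠ a) :
    entry (insertCycle n (τ, a)) (k + 1) = entry τ (k + 1) := by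
  have hswap : ((Equiv.swap a (Fin.last n)).trans finSuccEquivLast) (Fin.castSucc ⟨k, hk⟩) =
      some ⟨k, hk⟩ := by
    rw [Equiv.trans_apply, Equiv.swap_apply_of_ne_of_ne (by simpa [Fin.ext_iff] using hka)
      (Fin.castSucc_ne_last _), finSuccEquivLast_castSucc]
  have h := entry_succ (insertCycle n (τ, a)) (Fin.castSucc ⟨k, hk⟩)
  rw [insertCycle, insertPoint_of_eq_some _ _ _ _ hswap, finSuccEquivLast_symm_some] at h
  simpa [insertCycle] using h.trans (entry_succ τ ⟨k, hk⟩).symm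

end InsertCycle

section AscentsMatch

/-- The letters `x`, `y` stand next to each other, in this order, in the word `0 σ_1 ⋯ σ_n`. -/
def Consecutive (σ : Equiv.Perm (Fin n)) (x y : ℕ) : Prop :=
  ∃ i < n, entry σ i = x ∧ entry σ (i + 1) = y

/-- The ascents `x < y` of the word `0 σ_1 ⋯ σ_n` are exactly the weak excedances `x + 1 ↦ y` of
`τ`. -/
def AscentsMatch (σ τ : Equiv.Perm (Fin n)) : Prop :=
  ∀ x y, x < y → (Consecutive σ x y ↔ entry τ (x + 1) = y)

lemma consecutive_insertWord_iff (σ : Equiv.Perm (Fin n)) (p : Fin (n + 1)) {x y : ℕ}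
    (hxy : x < y) :
    Consecutive (insertWord n (σ, p)) x y ↔
      if x = entry σ p then y = n + 1 else Consecutive σ x y := by
  have hp : (p : ℕ) ≤ n := by omega
  have hne {i : ℕ} (hi : i ≤ n) (hip : i ≠ p) : entry σ i ≠ entry σ p :=
    (entry_injOn σ).ne hi hp hip
  constructor
  · rintro ⟨i, hi, rfl, rfl⟩
    obtain hip | rfl | rfl | hip : i < p ∨ i = p ∨ i = p + 1 ∨ p + 1 < i := by omega
    · rw [entry_insertWord_of_le σ p hip.le, entry_insertWord_of_le σ p hip,
        if_neg (hne (by omega) hip.ne)]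
      exact ⟨i, by omega, rfl, rfl⟩
    · rw [entry_insertWord_of_le σ p le_rfl, entry_insertWord_self, if_pos rfl]
    · have := entry_le (insertWord n (σ, p)) (p + 1 + 1)
      rw [entry_insertWord_self] at hxy
      omega
    · obtain ⟨j, rfl⟩ : ∃ j, i = j + 1 := ⟨i - 1, by omega⟩
      rw [entry_insertWord_of_lt σ p (by omega) (by omega),
        entry_insertWord_of_lt σ p (by omega) (by omega), if_neg (hne (by omega) (by omega))]
      exact ⟨j, by omega, rfl, rfl⟩
  · split_ifs with hx
    · rintro rfl
      exact ⟨p, p.isLt, by rw [hx, entry_insertWord_of_le σ p le_rfl], entry_insertWord_self σ p⟩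
    · rintro ⟨i, hi, rfl, rfl⟩
      obtain hip | hip : i < p ∨ p < i := by
        have : i ≠ p := fun h => hx (by rw [h])
        omega
      · exact ⟨i, by omega, entry_insertWord_of_le σ p hip.le, entry_insertWord_of_le σ p hip⟩
      · exact ⟨i + 1, by omega, entry_insertWord_of_lt σ p hip hi.le,
          entry_insertWord_of_lt σ p (by omega) hi⟩

lemma entry_insertCycle_eq_iff (τ : Equiv.Perm (Fin n)) (a : Fin (n + 1)) {x y : ℕ}
    (hxy : x < y) :
    entry (insertCycle n (τ, a)) (x + 1) = y ↔
      if x = a then y = n + 1 else entry τ (x + 1) = y := by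
  split_ifs with hxa
  · rw [hxa, entry_insertCycle_self, eq_comm]
  obtain hxn | rfl | hxn := lt_trichotomy x n
  · rw [entry_insertCycle_of_ne τ a hxn hxa]
  · have := entry_le τ (a + 1)
    rw [entry_insertCycle_last τ a (by omega), entry_of_gt τ x.lt_succ_self]
    omega
  · rw [entry_of_gt _ (by omega), entry_of_gt τ (by omega)]

lemma AscentsMatch.insert {σ τ : Equiv.Perm (Fin n)} (h : AscentsMatch σ τ) (p : Fin (n + 1)) :
    AscentsMatch (insertWord n (σ, p)) (insertCycle n (τ, word σ p)) := by
  intro x y hxy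
  rw [consecutive_insertWord_iff σ p hxy, entry_insertCycle_eq_iff τ _ hxy, coe_word, h x y hxy]

/-- The bijection of the theorem, for all sets `I` at once: take the letters `n, …, 1` out of the
word of `σ`, and put each of them back into the cycles of a permutation, where the preimage of the
inserted letter is one more than the letter it stood behind. -/
def ascentEquiv : ∀ n, Equiv.Perm (Fin n) ≃ Equiv.Perm (Fin n)
  | 0 => Equiv.refl _
  | n + 1 => (insertWord n).symm.trans (((ascentEquiv n).prodShear word).trans (insertCycle n))

theorem ascentsMatch_ascentEquiv : ∀ {n : ℕ} (σ : Equiv.Perm (Fin n)),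
    AscentsMatch σ (ascentEquiv n σ)
  | 0, σ => fun x y hxy => by
    simp [Consecutive, entry_of_gt _ x.succ_pos, (Nat.zero_lt_of_lt hxy).ne]
  | n + 1, σ => by
    obtain ⟨⟨ρ, p⟩, rfl⟩ := (insertWord n).surjective σ
    simpa [ascentEquiv] using (ascentsMatch_ascentEquiv ρ).insert p

end AscentsMatch

section Values

lemma mem_leftSuccValues_iff {σ : Equiv.Perm (Fin n)} {v : ℕ} :
    v ∈ leftSuccValues σ ↔ ∃ x, Consecutive σ x v ∧ x + 1 = v := by
  simp only [leftSuccValues, Finset.mem_image, Finset.mem_filter, Finset.mem_Icc]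
  constructor
  · rintro ⟨i, ⟨⟨h1, hi⟩, hs⟩, rfl⟩
    exact ⟨_, ⟨i - 1, by omega, rfl, by rw [Nat.sub_add_cancel h1]⟩, hs⟩
  · rintro ⟨_, ⟨i, hi, rfl, rfl⟩, hs⟩
    exact ⟨i + 1, ⟨⟨by omega, hi⟩, hs⟩, rfl⟩

lemma mem_jumpValues_iff {σ : Equiv.Perm (Fin n)} {v : ℕ} :
    v ∈ jumpValues σ ↔ ∃ x, Consecutive σ x v ∧ x + 2 ≤ v := by
  simp only [jumpValues, jumps, Finset.mem_image, Finset.mem_filter, Finset.mem_Icc]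
  constructor
  · rintro ⟨i, ⟨⟨h1, hi⟩, hj⟩, rfl⟩
    exact ⟨_, ⟨i - 1, by omega, rfl, by rw [Nat.sub_add_cancel h1]⟩, hj⟩
  · rintro ⟨_, ⟨i, hi, rfl, rfl⟩, hj⟩
    exact ⟨i + 1, ⟨⟨by omega, hi⟩, hj⟩, rfl⟩

lemma mem_fixedPoints_iff {τ : Equiv.Perm (Fin n)} {v : ℕ} :
    v ∈ fixedPoints τ ↔ ∃ x, entry τ (x + 1) = v ∧ x + 1 = v := by
  simp only [fixedPoints, Finset.mem_filter, Finset.mem_Icc]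
  constructor
  · rintro ⟨⟨h1, -⟩, hv⟩
    exact ⟨v - 1, by rwa [Nat.sub_add_cancel h1], Nat.sub_add_cancel h1⟩
  · rintro ⟨x, hx, rfl⟩
    exact ⟨⟨by omega, hx ▸ entry_le τ _⟩, hx⟩

lemma mem_excValues_iff {τ : Equiv.Perm (Fin n)} {v : ℕ} :
    v ∈ excValues τ ↔ ∃ x, entry τ (x + 1) = v ∧ x + 2 ≤ v := by
  simp only [excValues, excedances, Finset.mem_image, Finset.mem_filter, Finset.mem_Icc]
  constructor
  · rintro ⟨k, ⟨⟨h1, -⟩, hk⟩, rfl⟩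
    exact ⟨k - 1, by rw [Nat.sub_add_cancel h1], by omega⟩
  · rintro ⟨x, rfl, hx⟩
    have := entry_le τ (x + 1)
    exact ⟨x + 1, ⟨⟨by omega, by omega⟩, hx⟩, rfl⟩

variable {σ τ : Equiv.Perm (Fin n)}

lemma AscentsMatch.leftSuccValues_eq (h : AscentsMatch σ τ) :
    leftSuccValues σ = fixedPoints τ := by
  ext v
  rw [mem_leftSuccValues_iff, mem_fixedPoints_iff]
  exact exists_congr fun x => and_congr_left fun hx => h x v (by omega)

lemma AscentsMatch.jumpValues_eq (h : AscentsMatch σ τ) : jumpValues σ = excValues τ := by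
  ext v
  rw [mem_jumpValues_iff, mem_excValues_iff]
  exact exists_congr fun x => and_congr_left fun hx => h x v (by omega)

end Values

section Counting

open Finset

lemma card_filter_eq_add_lt_add_gt {ι α : Type*} [LinearOrder α] (s : Finset ι) (f g : ι → α) :
    #{i ∈ s | f i = g i} + #{i ∈ s | f i < g i} + #{i ∈ s | g i < f i} = #s := by
  rw [card_filter, card_filter, card_filter, ← sum_add_distrib, ← sum_add_distrib,
    card_eq_sum_ones]
  refine sum_congr rfl fun i _ => ?_
  obtain h | h | h := lt_trichotomy (f i) (g i)
  · simp [h, h.ne, h.not_gt]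
  · simp [h]
  · simp [h, h.ne', h.not_gt]

lemma card_image_entry (σ : Equiv.Perm (Fin n)) {s : Finset ℕ} (hs : s ⊆ Icc 1 n) :
    #(s.image (entry σ)) = #s :=
  card_image_of_injOn <| (entry_injOn σ).mono fun _ hi => (mem_Icc.mp (hs hi)).2

lemma card_jumpValues (σ : Equiv.Perm (Fin n)) : #(jumpValues σ) = jump σ :=
  card_image_entry σ (filter_subset _ _)

lemma card_excValues (τ : Equiv.Perm (Fin n)) : #(excValues τ) = exc τ :=
  card_image_entry τ (filter_subset _ _)

lemma card_fixedPoints_add_drop_add_exc (τ : Equiv.Perm (Fin n)) :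
    #(fixedPoints τ) + drop τ + exc τ = n :=
  (card_filter_eq_add_lt_add_gt (Icc 1 n) (entry τ) id).trans (by simp)

lemma map_succ_descents (σ : Equiv.Perm (Fin n)) :
    (descents σ).map (addRightEmbedding 1) =
      {i ∈ Icc 1 n | entry σ i < entry σ (i - 1) + 1} := by
  ext i
  simp only [descents, mem_map, mem_filter, mem_Icc, addRightEmbedding_apply]
  constructor
  · rintro ⟨i, ⟨⟨h1, hi⟩, hd⟩, rfl⟩
    exact ⟨by omega, Nat.lt_succ_of_lt hd⟩
  · rintro ⟨⟨h1, hi⟩, hd⟩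
    have hne : entry σ i ≠ entry σ (i - 1) :=
      (entry_injOn σ).ne hi (Set.mem_Iic.mpr (by omega)) (by omega)
    have hpos := one_le_entry σ h1 hi
    have hi1 : i ≠ 1 := by
      rintro rfl
      rw [Nat.sub_self, entry_zero] at hd
      omega
    refine ⟨i - 1, ⟨by omega, ?_⟩, Nat.sub_add_cancel h1⟩
    rw [Nat.sub_add_cancel h1]
    omega

lemma card_leftSuccValues_add_jump_add_des (σ : Equiv.Perm (Fin n)) :
    #(leftSuccValues σ) + jump σ + des σ = n := by
  rw [leftSuccValues, card_image_entry σ (filter_subset _ _), des,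
    ← card_map (addRightEmbedding 1) (s := descents σ), map_succ_descents]
  exact (card_filter_eq_add_lt_add_gt (Icc 1 n) (fun i => entry σ (i - 1) + 1) (entry σ)).trans
    (by simp)

variable {σ τ : Equiv.Perm (Fin n)}

lemma AscentsMatch.jump_eq (h : AscentsMatch σ τ) : jump σ = exc τ := by
  rw [← card_jumpValues, h.jumpValues_eq, card_excValues]

lemma AscentsMatch.des_eq (h : AscentsMatch σ τ) : des σ = drop τ := by
  have hσ := card_leftSuccValues_add_jump_add_des σ
  have hτ := card_fixedPoints_add_drop_add_exc τ
  rw [h.leftSuccValues_eq, h.jump_eq] at hσ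
  omega

end Counting

end LeftSuccession

theorem theorem4p3 (n : ℕ) (hn : 1 ≤ n) (I : Finset ℕ) (hI : I ⊆ Finset.Icc 1 n) :
    ∃ Φ : LeftSuccession.leftSuccPerms n I ≃ LeftSuccession.fixPerms n I,
      ∀ σ : LeftSuccession.leftSuccPerms n I,
        LeftSuccession.jump σ.1 = LeftSuccession.exc (Φ σ).1 ∧
        LeftSuccession.des σ.1 = LeftSuccession.drop (Φ σ).1 ∧
        LeftSuccession.jumpValues σ.1 = LeftSuccession.excValues (Φ σ).1 := by
  have hΨ := LeftSuccession.ascentsMatch_ascentEquiv (n := n)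
  refine ⟨(LeftSuccession.ascentEquiv n).subtypeEquiv fun σ => ?_, fun ⟨σ, _⟩ => ?_⟩
  · rw [LeftSuccession.leftSuccPerms, LeftSuccession.fixPerms, Set.mem_ofPred_eq,
      Set.mem_ofPred_eq, (hΨ σ).leftSuccValues_eq]
  · exact ⟨(hΨ σ).jump_eq, (hΨ σ).des_eq, (hΨ σ).jumpValues_eq⟩
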